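/- Let $F$ be a free group, and let $H$ and $K$ be nontrivial finitely generated subgroups of $F$, of ranks $h$ and $k$ respectively. Let $H\vee K=\langle H,K\rangle$ denote the subgroup of $F$ generated by $H\cup K$. If \[ \mathrm{rank}(H\vee K)-1\ \ge\ \frac{h+k-1}{2}, \] then $H\cap K$ is finitely generated and \[ \mathrm{rank}(H\cap K)-1\ \le\ (h-1)(k-1). \] -/

import Mathlib

/-- The join of two finitely generated subgroups is finitely generated, so that its rank
`Group.rank` (the least number of generators) makes sense. -/
instance joinFG {F : Type*} [Group F] (H K : Subgroup F) [hH : Group.FG H] [hK : Group.FG K] :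
    Group.FG (H ⊔ K : Subgroup F) :=
  (Group.fg_iff_subgroup_fg _).2
    (((Group.fg_iff_subgroup_fg H).1 hH).sup ((Group.fg_iff_subgroup_fg K).1 hK))

/-!
A finitely generated subgroup `L` of a free group acts freely on a subtree `T` of the Cayley tree
with finitely many orbits, and Euler's formula on `T / L` gives
`b₁(L) - 1 = #(edge orbits) - #(vertex orbits)`.
Left orders on free groups make it possible to order the vertices and the edges of the Cayley tree
invariantly. Add the edges of `T` one by one in increasing order, and let every finite component be
led by its least vertex. An edge that does not join two infinite components makes exactly one
vertex lose its leadership, and if `L` is nontrivial then every vertex loses it at some edge: a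
finite component of vertices is never moved into itself by an element other than `1`, so it has at
most as many vertices as there are vertex orbits. This pairing is equivariant, so `b₁(L) - 1` is the
number of orbits of essential edges, those which join two infinite components.

An edge of `T ∩ T'` that is essential in `T ∩ T'` is essential in `T` and in `T'`, and an orbit
of `H ⊓ K` is determined by the orbits of `H` and of `K` that contain it. Hence the number of orbits
of essential edges is submultiplicative.
-/

open Set Function MulAction
open scoped Pointwise

/-! ### Directed graphs and forests -/

/-- A directed graph with loops and multiple edges, with vertex set `V` and edge set `E`. -/
structure Multidigraph (V E : Type*) where
  src : E → V
  tgt : E → V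

namespace Multidigraph

section Connectivity

variable {V E : Type*} (G : Multidigraph V E) {S T : Set E} {x y z : V} {e : E}

/-- Two vertices are joined by `S` if some path between them, with edges traversed in either
direction, uses only edges of `S`. -/
def joined (S : Set E) : Setoid V :=
  Relation.EqvGen.setoid fun x y => ∃ e ∈ S, G.src e = x ∧ G.tgt e = y

/-- The connected component of the vertex `x` in the subgraph with edge set `S`. -/
def component (S : Set E) (x : V) : Set V :=
  {y | G.joined S x y}

/-- Any two vertices are joined by a path; the empty graph counts as connected. -/
def IsConnected : Prop :=
  ∀ x y, G.joined univ x y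

/-- The edges of the full subgraph on a set of vertices. -/
def spanned (X : Set V) : Set E :=
  {e | G.src e ∈ X ∧ G.tgt e ∈ X}

/-- The full subgraph on `X` is connected. -/
def ConnectedOn (X : Set V) : Prop :=
  ∀ x ∈ X, ∀ y ∈ X, G.joined (G.spanned X) x y

/-- A graph is a forest if every rational 1-cochain is a coboundary, that is, if its first
cohomology vanishes. -/
def IsForest : Prop :=
  ∀ c : E → ℚ, ∃ f : V → ℚ, ∀ e, f (G.tgt e) - f (G.src e) = c e

variable {G}

theorem joined_le {r : Setoid V} (h : ∀ e ∈ S, r (G.src e) (G.tgt e)) : G.joined S ≤ r := by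
  refine Setoid.eqvGen_le ?_
  rintro _ _ ⟨e, he, rfl, rfl⟩
  exact h e he

theorem joined_src_tgt (he : e ∈ S) : G.joined S (G.src e) (G.tgt e) :=
  .rel _ _ ⟨e, he, rfl, rfl⟩

theorem joined_mono (h : S ⊆ T) : G.joined S ≤ G.joined T :=
  joined_le fun _ he => joined_src_tgt (h he)

theorem eq_of_joined {α : Type*} {u : V → α} (hu : ∀ e ∈ S, u (G.src e) = u (G.tgt e))
    (h : G.joined S x y) : u x = u y :=
  joined_le (r := Setoid.ker u) hu h

theorem mem_component_self : x ∈ G.component S x :=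
  (G.joined S).refl x

theorem component_mono (h : S ⊆ T) (x : V) : G.component S x ⊆ G.component T x :=
  fun _ hy => joined_mono h hy

theorem component_eq (h : y ∈ G.component S x) : G.component S y = G.component S x :=
  ext fun _ => ⟨(G.joined S).trans h, (G.joined S).trans ((G.joined S).symm h)⟩

theorem component_subset {X : Set V} (hx : x ∈ X)
    (hX : ∀ e ∈ S, G.src e ∈ X ↔ G.tgt e ∈ X) : G.component S x ⊆ X :=
  fun _ hy => (eq_of_joined (u := (· ∈ X)) (fun e he => propext (hX e he)) hy).mp hx

theorem src_mem_component_iff (he : e ∈ S) :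
    G.src e ∈ G.component S x ↔ G.tgt e ∈ G.component S x :=
  ⟨fun h => (G.joined S).trans h (joined_src_tgt he),
    fun h => (G.joined S).trans h ((G.joined S).symm (joined_src_tgt he))⟩

theorem component_insert_eq_self (h : G.src e ∉ G.component S x)
    (h' : G.tgt e ∉ G.component S x) : G.component (insert e S) x = G.component S x := by
  refine (component_subset mem_component_self ?_).antisymm (component_mono (subset_insert e S) x)
  rintro d (rfl | hd)
  exacts [iff_of_false h h', src_mem_component_iff hd]

theorem component_insert_src :
    G.component (insert e S) (G.src e) = G.component S (G.src e) ∪ G.component S (G.tgt e) := by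
  have he : G.tgt e ∈ G.component (insert e S) (G.src e) := joined_src_tgt (mem_insert e S)
  refine (component_subset (.inl mem_component_self) ?_).antisymm
    (union_subset (component_mono (subset_insert e S) _) ?_)
  · rintro d (rfl | hd)
    · exact iff_of_true (.inl mem_component_self) (.inr mem_component_self)
    · exact or_congr (src_mem_component_iff hd) (src_mem_component_iff hd)
  · exact component_eq he ▸ component_mono (subset_insert e S) _

theorem IsForest.not_joined (hG : G.IsForest) (he : e ∉ S) :
    ¬ G.joined S (G.src e) (G.tgt e) := by
  classical
  intro h
  obtain ⟨f, hf⟩ := hG (Pi.single e 1)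
  have hS : f (G.src e) = f (G.tgt e) := eq_of_joined (fun d hd => by
    have := hf d
    rw [Pi.single_eq_of_ne (ne_of_mem_of_not_mem hd he)] at this
    exact (sub_eq_zero.1 this).symm) h
  have := hf e
  simp [hS] at this

/-- The potential of the part of `du` supported on `S`, where `u` is the indicator of a component
of `S ∩ T`, differs from `u` by a constant along `S` and is constant along `T`. -/
theorem IsForest.joined_inter (hG : G.IsForest) (hS : G.joined S x y) (hT : G.joined T x y) :
    G.joined (S ∩ T) x y := by
  classical
  let u : V → ℚ := (G.component (S ∩ T) x).indicator 1
  have hu : ∀ e ∈ S ∩ T, u (G.src e) = u (G.tgt e) := fun e he => by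
    simp only [u, indicator_apply, src_mem_component_iff he, Pi.one_apply]
  obtain ⟨f, hf⟩ := hG fun e => if e ∈ S then u (G.tgt e) - u (G.src e) else 0
  have hfS : u x - f x = u y - f y := eq_of_joined (u := fun v => u v - f v) (fun e he => by
    have := hf e
    rw [if_pos he] at this
    linarith) hS
  have hfT : f x = f y := eq_of_joined (fun e he => by
    have := hf e
    split_ifs at this with heS
    · linarith [hu e ⟨heS, he⟩]
    · linarith) hT
  have hxy : u x = u y := by linarith
  have hx : u x = 1 := indicator_of_mem mem_component_self 1
  exact mem_of_indicator_ne_zero (hxy ▸ hx ▸ one_ne_zero : u y ≠ 0)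

theorem IsForest.connectedOn_inter {X Y : Set V} (hG : G.IsForest) (hX : G.ConnectedOn X)
    (hY : G.ConnectedOn Y) : G.ConnectedOn (X ∩ Y) := fun x hx y hy =>
  joined_mono (T := G.spanned (X ∩ Y)) (fun _ he => ⟨⟨he.1.1, he.2.1⟩, ⟨he.1.2, he.2.2⟩⟩)
    (hG.joined_inter (hX x hx.1 y hy.1) (hY x hx.2 y hy.2))

end Connectivity

section Hom

variable {V E V' E' : Type*} {G : Multidigraph V E} {G' : Multidigraph V' E'} {φ : V → V'}
  {ψ : E → E'}

/-- The maps `φ` on vertices and `ψ` on edges form a homomorphism of graphs. -/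
structure IsHom (G : Multidigraph V E) (G' : Multidigraph V' E') (φ : V → V') (ψ : E → E') :
    Prop where
  src_map : ∀ e, G'.src (ψ e) = φ (G.src e)
  tgt_map : ∀ e, G'.tgt (ψ e) = φ (G.tgt e)

theorem IsHom.joined_map {S : Set E} {S' : Set E'} {x y : V} (h : IsHom G G' φ ψ)
    (hS : MapsTo ψ S S') (hxy : G.joined S x y) : G'.joined S' (φ x) (φ y) := by
  refine joined_le (r := (G'.joined S').comap φ) (fun e he => ?_) hxy
  change G'.joined S' _ _
  rw [← h.src_map, ← h.tgt_map]
  exact joined_src_tgt (hS he)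

theorem IsHom.mapsTo_component {S : Set E} {S' : Set E'} (h : IsHom G G' φ ψ)
    (hS : MapsTo ψ S S') (x : V) : MapsTo φ (G.component S x) (G'.component S' (φ x)) :=
  fun _ hy => h.joined_map hS hy

end Hom

end Multidigraph

/-! ### The elder rule -/

namespace Multidigraph

section Leader

variable {V E : Type*} [LinearOrder V] (G : Multidigraph V E)

/-- The vertex `v` leads its component in the subgraph with edge set `S` if that component is
finite and `v` is its least vertex. -/
def IsLeader (S : Set E) (v : V) : Prop :=
  (G.component S v).Finite ∧ v ∈ lowerBounds (G.component S v)

variable {G} {S T : Set E} {v w x : V}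

theorem IsLeader.anti (hST : S ⊆ T) (h : G.IsLeader T v) : G.IsLeader S v :=
  ⟨h.1.subset (component_mono hST v), lowerBounds_mono_set (component_mono hST v) h.2⟩

theorem IsLeader.eq (hv : G.IsLeader S v) (hw : G.IsLeader S w) (h : G.joined S v w) : v = w :=
  (hv.2 h).antisymm (hw.2 ((G.joined S).symm h))

theorem exists_isLeader (hx : (G.component S x).Finite) :
    ∃ v ∈ G.component S x, G.IsLeader S v := by
  obtain ⟨v, hv, hmin⟩ := exists_min_image _ id hx ⟨x, mem_component_self⟩
  exact ⟨v, hv, by rw [IsLeader, component_eq hv]; exact ⟨hx, hmin⟩⟩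

end Leader

section ElderRule

variable {V E : Type*} (G : Multidigraph V E)

/-- Only finitely many edges start or end at a given vertex. -/
def IsLocallyFinite : Prop :=
  ∀ x, {e | G.src e = x ∨ G.tgt e = x}.Finite

variable [LinearOrder E]

/-- An edge is essential if it joins two infinite components of the graph formed by all smaller
edges. -/
def IsEssential (e : E) : Prop :=
  (G.component (Iio e) (G.src e)).Infinite ∧ (G.component (Iio e) (G.tgt e)).Infinite

/-- When the edges are added one by one in increasing order, `e` is the edge whose addition makes
`v` lose its leadership. This is the pairing of the elder rule in persistent homology. -/
def Kills [LinearOrder V] (e : E) (v : V) : Prop :=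
  G.IsLeader (Iio e) v ∧ ¬ G.IsLeader (Iic e) v

variable {G} {S : Set E} {d e : E} {v w : V}

theorem component_Iic_src : G.component (Iic e) (G.src e) =
    G.component (Iio e) (G.src e) ∪ G.component (Iio e) (G.tgt e) := by
  rw [← Iio_insert, component_insert_src]

theorem IsConnected.exists_component_Iio_eq [Infinite V] (hG : G.IsConnected)
    (hfin : G.IsLocallyFinite) (hS : IsLowerSet S) (hv : (G.component S v).Finite) :
    ∃ e, G.component (Iio e) v = G.component S v ∧ G.component S v ⊂ G.component (Iic e) v := by
  set C := G.component S v
  let leaving : Set E := {e | ¬ (G.src e ∈ C ↔ G.tgt e ∈ C)}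
  have hleaving : leaving.Finite := by
    refine (hv.biUnion fun x _ => hfin x).subset fun e he => ?_
    rcases not_iff.1 he with he
    by_cases hs : G.src e ∈ C
    · exact mem_biUnion hs (.inl rfl)
    · exact mem_biUnion (he.1 hs) (.inr rfl)
  have hne : leaving.Nonempty := by
    by_contra! hempty
    refine infinite_univ (hv.subset fun x _ => component_subset (S := univ) mem_component_self
      (fun e _ => ?_) (hG v x))
    by_contra he
    exact (hempty ▸ he : e ∈ (∅ : Set E))
  obtain ⟨e, he, hmin⟩ := exists_min_image _ id hleaving hne
  have hSe : S ⊆ Iio e := fun d hd => lt_of_not_ge fun hle =>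
    he (src_mem_component_iff (hS hle hd))
  have hIio : G.component (Iio e) v = C := by
    refine (component_subset mem_component_self fun d hd => ?_).antisymm (component_mono hSe v)
    by_contra hd'
    exact (hmin d hd').not_gt hd
  have hle : C ⊆ G.component (Iic e) v := hIio ▸ component_mono Iio_subset_Iic_self v
  refine ⟨e, hIio, hle.ssubset_of_ne fun heq => he ?_⟩
  rw [heq]
  exact src_mem_component_iff self_mem_Iic

variable [LinearOrder V]

theorem Kills.edge_unique (hd : G.Kills d v) (he : G.Kills e v) : d = e := by
  have not_lt : ∀ {d e}, G.Kills d v → G.Kills e v → ¬ d < e := fun hd he hlt =>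
    hd.2 (he.1.anti fun _ hx => lt_of_le_of_lt hx hlt)
  exact (not_lt_iff_eq_or_lt.1 (not_lt hd he)).resolve_right (not_lt he hd)

theorem Kills.mem_component (h : G.Kills e v) :
    G.src e ∈ G.component (Iio e) v ∨ G.tgt e ∈ G.component (Iio e) v := by
  by_contra! hv
  apply h.2
  rw [IsLeader, ← Iio_insert, component_insert_eq_self hv.1 hv.2]
  exact h.1

theorem Kills.not_isEssential (h : G.Kills e v) : ¬ G.IsEssential e := by
  rintro ⟨hs, ht⟩
  rcases h.mem_component with hv | hv
  · exact hs (component_eq hv ▸ h.1.1)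
  · exact ht (component_eq hv ▸ h.1.1)

theorem Kills.component_Iic_eq_union (hv : G.Kills e v) (hw : G.Kills e w)
    (hvw : ¬ G.joined (Iio e) v w) :
    G.component (Iic e) v = G.component (Iio e) v ∪ G.component (Iio e) w := by
  have union_eq : G.component (Iio e) (G.src e) ∪ G.component (Iio e) (G.tgt e) =
      G.component (Iio e) v ∪ G.component (Iio e) w := by
    rcases hv.mem_component with hv | hv <;> rcases hw.mem_component with hw | hw
    · exact absurd ((G.joined _).trans hv ((G.joined _).symm hw)) hvw
    · rw [component_eq hv, component_eq hw]
    · rw [component_eq hv, component_eq hw, union_comm]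
    · exact absurd ((G.joined _).trans hv ((G.joined _).symm hw)) hvw
  have hmem : v ∈ G.component (Iic e) (G.src e) :=
    component_Iic_src.trans union_eq ▸ .inl mem_component_self
  rw [component_eq hmem, component_Iic_src, union_eq]

theorem Kills.vertex_unique (hv : G.Kills e v) (hw : G.Kills e w) : v = w := by
  wlog hle : v ≤ w generalizing v w
  · exact (this hw hv (le_of_not_ge hle)).symm
  by_contra hne
  have hunion := hv.component_Iic_eq_union hw fun h => hne (hv.1.eq hw.1 h)
  refine hv.2 ⟨hunion ▸ hv.1.1.union hw.1.1, hunion ▸ ?_⟩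
  rintro x (hx | hx)
  exacts [hv.1.2 hx, hle.trans (hw.1.2 hx)]

theorem IsForest.exists_kills (hG : G.IsForest) (he : ¬ G.IsEssential e) : ∃ v, G.Kills e v := by
  by_contra! h
  have hsurvive {x : V} (hxM : x ∈ G.component (Iic e) (G.src e))
      (hx : (G.component (Iio e) x).Finite) : (G.component (Iic e) (G.src e)).Finite ∧
        ∃ v ∈ G.component (Iio e) x, v ∈ lowerBounds (G.component (Iic e) (G.src e)) := by
    obtain ⟨v, hvx, hv⟩ := exists_isLeader hx
    have hvM := (component_eq hxM) ▸ component_mono Iio_subset_Iic_self x hvx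
    have := not_not.1 (not_and.1 (h v) hv)
    rw [IsLeader, component_eq hvM] at this
    exact ⟨this.1, v, hvx, this.2⟩
  have hs : G.src e ∈ G.component (Iic e) (G.src e) := mem_component_self
  have ht : G.tgt e ∈ G.component (Iic e) (G.src e) := joined_src_tgt self_mem_Iic
  have hfin : (G.component (Iic e) (G.src e)).Finite := by
    rcases not_and_or.1 he with hx | hx
    exacts [(hsurvive hs (not_infinite.1 hx)).1, (hsurvive ht (not_infinite.1 hx)).1]
  rw [component_Iic_src] at hfin
  obtain ⟨-, v, hv, hvmin⟩ := hsurvive hs (hfin.subset subset_union_left)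
  obtain ⟨-, w, hw, hwmin⟩ := hsurvive ht (hfin.subset subset_union_right)
  rw [component_Iic_src] at hvmin hwmin
  obtain rfl : v = w := (hvmin (.inr hw)).antisymm (hwmin (.inl hv))
  exact hG.not_joined self_notMem_Iio ((G.joined _).trans hv ((G.joined _).symm hw))

theorem IsConnected.exists_isLeader_le_ncard [Infinite V] (hG : G.IsConnected)
    (hfin : G.IsLocallyFinite) (hv : ∀ e, ¬ G.Kills e v) (n : ℕ) :
    ∃ S : Set E, IsLowerSet S ∧ G.IsLeader S v ∧ n ≤ (G.component S v).ncard := by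
  induction n with
  | zero =>
    have hempty : G.component ∅ v ⊆ {v} := component_subset rfl fun e he => he.elim
    exact ⟨∅, isLowerSet_empty, ⟨(finite_singleton v).subset hempty,
      fun x hx => (mem_singleton_iff.1 (hempty hx)).ge⟩, Nat.zero_le _⟩
  | succ n ih =>
    obtain ⟨S, hS, hlead, hn⟩ := ih
    obtain ⟨e, hIio, hlt⟩ := hG.exists_component_Iio_eq hfin hS hlead.1
    have hleadIio : G.IsLeader (Iio e) v := by rwa [IsLeader, hIio]
    have hleadIic : G.IsLeader (Iic e) v := not_not.1 (not_and.1 (hv e) hleadIio)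
    exact ⟨Iic e, isLowerSet_Iic e, hleadIic, hn.trans_lt (ncard_lt_ncard hlt hleadIic.1)⟩

end ElderRule

end Multidigraph

/-! ### Equivariant orders -/

section OrbitCounting

variable {L α β : Type*} [Group L] [MulAction L α] [MulAction L β]

theorem orbit_mk_eq_iff {a b : α} :
    (⟦a⟧ : orbitRel.Quotient L α) = ⟦b⟧ ↔ ∃ g : L, g • b = a :=
  Quotient.eq.trans Iff.rfl

theorem ncard_orbits_le_of_rel {R : α → β → Prop} {S : Set (orbitRel.Quotient L α)}
    {T : Set (orbitRel.Quotient L β)} (hT : T.Finite)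
    (smul : ∀ (g : L) a b, R a b → R (g • a) (g • b))
    (left_unique : ∀ a a' b, R a b → R a' b → a = a')
    (total : ∀ a, ⟦a⟧ ∈ S → ∃ b, ⟦b⟧ ∈ T ∧ R a b) : S.ncard ≤ T.ncard := by
  have total' : ∀ q ∈ S, ∃ b, ⟦b⟧ ∈ T ∧ R q.out b := fun q hq =>
    total q.out (by rwa [Quotient.out_eq])
  choose f hfT hfR using total'
  have := hT.to_subtype
  rw [← Nat.card_coe_set_eq, ← Nat.card_coe_set_eq]
  refine Nat.card_le_card_of_injective (fun q : S => (⟨⟦f q q.2⟧, hfT q q.2⟩ : T))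
    fun q q' h => Subtype.ext ?_
  obtain ⟨g, hg⟩ := orbit_mk_eq_iff.1 (Subtype.ext_iff.1 h)
  rw [← Quotient.out_eq q.1, ← Quotient.out_eq q'.1]
  exact orbit_mk_eq_iff.2
    ⟨g, left_unique _ _ _ (smul g _ _ (hfR q' q'.2)) (by rw [hg]; exact hfR q q.2)⟩

end OrbitCounting

section OrderedAction

variable {L α : Type*} [Group L] [MulAction L α] [LinearOrder α]
  [CovariantClass L α HSMul.hSMul LT.lt]

/-- Translation by a group element, as an automorphism of the ordered set acted upon. -/
def smulOrderIso (α : Type*) [MulAction L α] [LinearOrder α] [CovariantClass L α HSMul.hSMul LT.lt]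
    (g : L) : α ≃o α :=
  (smul_strictMono_right g).orderIsoOfRightInverse _ (g⁻¹ • ·) (smul_inv_smul g)

theorem smul_set_Iio (g : L) (a : α) : g • Iio a = Iio (g • a) :=
  (smulOrderIso α g).image_Iio a

theorem smul_set_Iic (g : L) (a : α) : g • Iic a = Iic (g • a) :=
  (smulOrderIso α g).image_Iic a

theorem isLowerSet_smul_set {S : Set α} (hS : IsLowerSet S) (g : L) : IsLowerSet (g • S) :=
  hS.image (smulOrderIso α g)

theorem eq_one_of_smul_set_eq [IsCancelSMul L α] {C : Set α} (hfin : C.Finite) (hne : C.Nonempty)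
    {g : L} (hg : g • C = C) : g = 1 := by
  obtain ⟨m, hm, hmin⟩ := exists_min_image C id hfin hne
  have hle : m ≤ g • m := hmin _ (hg ▸ smul_mem_smul_set hm)
  have hge : m ≤ g⁻¹ • m := hmin _ (mem_smul_set_iff_inv_smul_mem.1 (hg.symm ▸ hm))
  have hge' : g • m ≤ m := by
    simpa only [smul_inv_smul] using (smul_strictMono_right g).monotone hge
  exact IsCancelSMul.eq_one_of_smul (hge'.antisymm hle)

theorem infinite_of_nontrivial_freeAction (L α : Type*) [Group L] [MulAction L α] [LinearOrder α]
    [CovariantClass L α HSMul.hSMul LT.lt] [IsCancelSMul L α] [Nontrivial L] [Nonempty α] :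
    Infinite α := by
  obtain ⟨g, hg⟩ := exists_ne (1 : L)
  refine infinite_univ_iff.1 fun hfin => hg ?_
  exact eq_one_of_smul_set_eq (α := α) hfin univ_nonempty smul_set_univ

end OrderedAction

namespace Multidigraph

variable {V E V' E' : Type*} {G : Multidigraph V E} {G' : Multidigraph V' E'}

theorem IsEssential.map [LinearOrder E] [LinearOrder E'] {φ : V → V'} {ψ : E → E'} {e : E}
    (he : G.IsEssential e) (h : IsHom G G' φ ψ) (hφ : Injective φ) (hψ : StrictMono ψ) :
    G'.IsEssential (ψ e) := by
  have infinite {x : V} (hx : (G.component (Iio e) x).Infinite) :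
      (G'.component (Iio (ψ e)) (φ x)).Infinite :=
    (hx.image hφ.injOn).mono (h.mapsTo_component (hψ.mapsTo_Iio (b := e)) x).image_subset
  rw [IsEssential, h.src_map, h.tgt_map]
  exact ⟨infinite he.1, infinite he.2⟩

/-- The group `L` acts on the graph by automorphisms. -/
def IsEquivariant (L : Type*) [SMul L V] [SMul L E] (G : Multidigraph V E) : Prop :=
  ∀ g : L, IsHom G G (g • ·) (g • ·)

section Equivariant

variable {L : Type*} [Group L] [MulAction L V] [MulAction L E]

theorem IsEquivariant.component_smul (hL : G.IsEquivariant L) (g : L) (S : Set E) (x : V) :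
    G.component (g • S) (g • x) = g • G.component S x := by
  have smul_mem (g : L) (S : Set E) (x : V) :
      g • G.component S x ⊆ G.component (g • S) (g • x) :=
    ((hL g).mapsTo_component (fun _ he => smul_mem_smul_set he) x).image_subset
  refine Subset.antisymm ?_ (smul_mem g S x)
  rw [← smul_set_subset_smul_set_iff (a := g⁻¹), inv_smul_smul]
  simpa only [inv_smul_smul] using smul_mem g⁻¹ (g • S) (g • x)

theorem IsEquivariant.isLocallyFinite [IsCancelSMul L V] [Finite (orbitRel.Quotient L E)]
    (hL : G.IsEquivariant L) : G.IsLocallyFinite := by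
  have finite_fiber {f : E → V} (hf : ∀ (g : L) e, f (g • e) = g • f e) (x : V) :
      {e | f e = x}.Finite := by
    refine Finite.of_injOn (f := fun e => (⟦e⟧ : orbitRel.Quotient L E)) (mapsTo_univ _ _)
      (fun d hd e he h => ?_) finite_univ
    obtain ⟨g, rfl⟩ := orbit_mk_eq_iff.1 h
    have hg : g • x = x := by rw [← he, ← hf, hd, he]
    rw [IsCancelSMul.eq_one_of_smul hg, one_smul]
  exact fun x => (finite_fiber (fun g => (hL g).src_map) x).union
    (finite_fiber (fun g => (hL g).tgt_map) x)

theorem IsEquivariant.isLeader_smul_iff [LinearOrder V]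
    [CovariantClass L V HSMul.hSMul LT.lt] (hL : G.IsEquivariant L) (g : L) {S : Set E} {v : V} :
    G.IsLeader (g • S) (g • v) ↔ G.IsLeader S v := by
  have hlb : lowerBounds (g • G.component S v) = g • lowerBounds (G.component S v) :=
    (smulOrderIso V g).lowerBounds_image
  rw [IsLeader, hL.component_smul, finite_smul_set, hlb, smul_mem_smul_set_iff, IsLeader]

variable [LinearOrder E] [CovariantClass L E HSMul.hSMul LT.lt]

theorem IsEquivariant.isEssential_smul_iff (hL : G.IsEquivariant L) (g : L) {e : E} :
    G.IsEssential (g • e) ↔ G.IsEssential e := by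
  have smul (g : L) {e : E} (he : G.IsEssential e) : G.IsEssential (g • e) :=
    he.map (hL g) (MulAction.injective g) (smul_strictMono_right g)
  exact ⟨fun h => inv_smul_smul g e ▸ smul g⁻¹ h, smul g⟩

/-- The orbits of essential edges. -/
def essentialOrbits (L : Type*) [Group L] [MulAction L E] (G : Multidigraph V E) :
    Set (orbitRel.Quotient L E) :=
  Quotient.mk _ '' {e | G.IsEssential e}

theorem IsEquivariant.mk_mem_essentialOrbits (hL : G.IsEquivariant L) {e : E} :
    ⟦e⟧ ∈ G.essentialOrbits L ↔ G.IsEssential e := by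
  refine ⟨?_, fun he => ⟨e, he, rfl⟩⟩
  rintro ⟨d, hd, h⟩
  obtain ⟨g, rfl⟩ := orbit_mk_eq_iff.1 h
  exact (hL.isEssential_smul_iff g).1 hd

variable [LinearOrder V] [CovariantClass L V HSMul.hSMul LT.lt]

theorem IsEquivariant.kills_smul (hL : G.IsEquivariant L) (g : L) {e : E} {v : V}
    (h : G.Kills e v) : G.Kills (g • e) (g • v) := by
  rwa [Kills, ← smul_set_Iio, ← smul_set_Iic, hL.isLeader_smul_iff, hL.isLeader_smul_iff]

theorem IsForest.card_edgeOrbits_le [Finite (orbitRel.Quotient L V)]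
    [Finite (orbitRel.Quotient L E)] (hG : G.IsForest) (hL : G.IsEquivariant L) :
    Nat.card (orbitRel.Quotient L E) ≤
      (G.essentialOrbits L).ncard + Nat.card (orbitRel.Quotient L V) := by
  rw [← ncard_add_ncard_compl (G.essentialOrbits L), ← ncard_univ (orbitRel.Quotient L V)]
  refine Nat.add_le_add_left (ncard_orbits_le_of_rel (R := G.Kills) finite_univ
    (fun g _ _ => hL.kills_smul g) (fun _ _ _ => Kills.edge_unique) fun e he => ?_) _
  obtain ⟨v, hv⟩ := hG.exists_kills (mt hL.mk_mem_essentialOrbits.2 he)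
  exact ⟨v, mem_univ _, hv⟩

variable [IsCancelSMul L V]

/-- Since a lower set and its translates are nested, so are a finite component and its translates;
being of the same size, they are then equal. -/
theorem IsEquivariant.injOn_component (hL : G.IsEquivariant L) {S : Set E} (hS : IsLowerSet S)
    {v : V} (hfin : (G.component S v).Finite) :
    InjOn (Quotient.mk (orbitRel L V)) (G.component S v) := by
  intro x hx y hy h
  obtain ⟨g, rfl⟩ := orbit_mk_eq_iff.1 h
  have htranslate : G.component (g • S) (g • y) = g • G.component S v := by
    rw [hL.component_smul, component_eq hy]
  have heq : g • G.component S v = G.component S v := by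
    rcases hS.total (isLowerSet_smul_set hS g) with hle | hle
    · have := component_mono (G := G) hle (g • y)
      rw [component_eq hx, htranslate] at this
      exact (eq_of_subset_of_ncard_le this (ncard_smul_set g _).le hfin.smul_set).symm
    · have := component_mono (G := G) hle (g • y)
      rw [component_eq hx, htranslate] at this
      exact eq_of_subset_of_ncard_le this (ncard_smul_set g _).ge hfin
  rw [eq_one_of_smul_set_eq hfin ⟨v, mem_component_self⟩ heq, one_smul]

theorem IsConnected.exists_edge_kills [Nontrivial L] [Finite (orbitRel.Quotient L V)]
    [Finite (orbitRel.Quotient L E)] (hG : G.IsConnected) (hL : G.IsEquivariant L) (v : V) :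
    ∃ e, G.Kills e v := by
  by_contra! h
  have := Nonempty.intro v
  have := infinite_of_nontrivial_freeAction L V
  obtain ⟨S, hS, hlead, hn⟩ := hG.exists_isLeader_le_ncard hL.isLocallyFinite h
    (Nat.card (orbitRel.Quotient L V) + 1)
  have hle := ncard_le_ncard_of_injOn (t := univ) _ (fun _ _ => mem_univ _)
    (hL.injOn_component hS hlead.1)
  rw [ncard_univ] at hle
  exact hn.not_gt (Nat.lt_succ_of_le hle)

theorem IsConnected.le_card_edgeOrbits [Nontrivial L] [Finite (orbitRel.Quotient L V)]
    [Finite (orbitRel.Quotient L E)] (hG : G.IsConnected) (hL : G.IsEquivariant L) :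
    (G.essentialOrbits L).ncard + Nat.card (orbitRel.Quotient L V) ≤
      Nat.card (orbitRel.Quotient L E) := by
  rw [← ncard_add_ncard_compl (G.essentialOrbits L), ← ncard_univ (orbitRel.Quotient L V)]
  refine Nat.add_le_add_left (ncard_orbits_le_of_rel (R := fun v e => G.Kills e v) (toFinite _)
    (fun g _ _ => hL.kills_smul g) (fun _ _ _ => Kills.vertex_unique) fun v _ => ?_) _
  obtain ⟨e, he⟩ := hG.exists_edge_kills hL v
  exact ⟨e, mt hL.mk_mem_essentialOrbits.1 he.not_isEssential, he⟩

end Equivariant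

end Multidigraph

/-! ### Rational cohomology and the Euler characteristic -/

/-- The first rational cohomology group of `L`, that is, the space of homomorphisms from `L` to
`ℚ`. -/
abbrev FirstCohomology (L : Type*) [Group L] : Type _ :=
  Additive L →+ ℚ

/-- The first rational Betti number of `L`, with junk value `0` if `FirstCohomology L` is infinite
dimensional. -/
noncomputable def firstBetti (L : Type*) [Group L] : ℕ :=
  Module.finrank ℚ (FirstCohomology L)

theorem finite_of_moduleFinite_fun {K ι : Type*} [Field K] [Module.Finite K (ι → K)] :
    Finite ι :=
  (Module.finite_finsupp_self_iff.1 (Module.Finite.of_injective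
    (Finsupp.lcoeFun : (ι →₀ K) →ₗ[K] (ι → K)) DFunLike.coe_injective)).resolve_left
      (not_subsingleton K)

section EquivariantFunctions

variable {L V : Type*} [Group L] [MulAction L V]

/-- Functions `f` on `V` together with a homomorphism `φ` from `L` to `ℚ` such that
`f (g • v) = f v + φ g`. -/
def equivariantFunctions (L V : Type*) [Group L] [MulAction L V] :
    Submodule ℚ ((V → ℚ) × FirstCohomology L) where
  carrier := {p | ∀ (g : L) (v : V), p.1 (g • v) = p.1 v + p.2 (.ofMul g)}
  add_mem' {p q} hp hq g v := by
    simp only [Prod.fst_add, Prod.snd_add, Pi.add_apply, AddMonoidHom.add_apply, hp g v, hq g v]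
    ring
  zero_mem' g v := by simp
  smul_mem' c p hp g v := by
    simp only [Prod.smul_fst, Prod.smul_snd, Pi.smul_apply, AddMonoidHom.smul_apply, smul_eq_mul,
      hp g v]
    ring

/-- The restriction of an equivariant function to chosen representatives of the orbits, together
with the associated homomorphism. -/
noncomputable def valuesOnOrbits (L V : Type*) [Group L] [MulAction L V] :
    equivariantFunctions L V →ₗ[ℚ] (orbitRel.Quotient L V → ℚ) × FirstCohomology L where
  toFun p := (fun q => p.1.1 q.out, p.1.2)
  map_add' _ _ := rfl
  map_smul' _ _ := rfl

theorem mk_smul_eq_mk (g : L) (v : V) : (⟦g • v⟧ : orbitRel.Quotient L V) = ⟦v⟧ :=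
  orbit_mk_eq_iff.2 ⟨g, rfl⟩

theorem exists_smul_out_eq (v : V) : ∃ g : L, g • (⟦v⟧ : orbitRel.Quotient L V).out = v :=
  orbit_mk_eq_iff.1 (Quotient.out_eq _).symm

theorem valuesOnOrbits_injective : Injective (valuesOnOrbits L V) := by
  rw [injective_iff_map_eq_zero]
  rintro ⟨⟨f, φ⟩, hf⟩ h
  obtain rfl : φ = 0 := congrArg Prod.snd h
  refine Subtype.ext (Prod.ext (funext fun v => ?_) rfl)
  obtain ⟨g, hg⟩ := exists_smul_out_eq (L := L) v
  have hrep : f (⟦v⟧ : orbitRel.Quotient L V).out = 0 := congrFun (congrArg Prod.fst h) _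
  calc f v = f (g • (⟦v⟧ : orbitRel.Quotient L V).out) := by rw [hg]
    _ = f (⟦v⟧ : orbitRel.Quotient L V).out + 0 := hf g _
    _ = 0 := by rw [hrep, add_zero]

theorem valuesOnOrbits_surjective [IsCancelSMul L V] : Surjective (valuesOnOrbits L V) := by
  rintro ⟨c, φ⟩
  choose γ hγ using exists_smul_out_eq (L := L) (V := V)
  have hγ_smul (g : L) (v : V) : γ (g • v) = g * γ v := by
    have h := hγ (g • v)
    rw [mk_smul_eq_mk] at h
    exact IsCancelSMul.right_cancel _ _ _ (h.trans (by rw [mul_smul, hγ]))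
  have hγ_out (q : orbitRel.Quotient L V) : γ q.out = 1 := by
    have h := hγ q.out
    rw [Quotient.out_eq] at h
    exact IsCancelSMul.eq_one_of_smul h
  refine ⟨⟨(fun v => c ⟦v⟧ + φ (.ofMul (γ v)), φ), fun g v => ?_⟩,
    Prod.ext (funext fun q => ?_) rfl⟩
  · simp only [hγ_smul, mk_smul_eq_mk, ofMul_mul, map_add]
    ring
  · change c ⟦q.out⟧ + φ (.ofMul (γ q.out)) = c q
    rw [hγ_out, Quotient.out_eq, ofMul_one, map_zero, add_zero]

end EquivariantFunctions

namespace Multidigraph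

section EulerCharacteristic

variable {L V E : Type*} [Group L] [MulAction L V] [MulAction L E] {G : Multidigraph V E}

/-- The coboundary of an equivariant function, as a function on the edge orbits, together with the
value of the function at `x`. -/
noncomputable def coboundary (L : Type*) [Group L] [MulAction L V] [MulAction L E]
    (G : Multidigraph V E) (x : V) :
    equivariantFunctions L V →ₗ[ℚ] (orbitRel.Quotient L E → ℚ) × ℚ where
  toFun p := (fun q => p.1.1 (G.tgt q.out) - p.1.1 (G.src q.out), p.1.1 x)
  map_add' _ _ := Prod.ext (funext fun _ => add_sub_add_comm _ _ _ _) rfl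
  map_smul' c _ := Prod.ext (funext fun _ => (mul_sub c _ _).symm) rfl

theorem IsEquivariant.coboundary_mk (hL : G.IsEquivariant L) (x : V)
    (p : equivariantFunctions L V) (e : E) :
    (coboundary L G x p).1 ⟦e⟧ = p.1.1 (G.tgt e) - p.1.1 (G.src e) := by
  obtain ⟨g, hg⟩ := exists_smul_out_eq (L := L) e
  conv_rhs => rw [← hg, (hL g).src_map, (hL g).tgt_map, p.2, p.2]
  exact (add_sub_add_right_eq_sub _ _ _).symm

theorem IsConnected.eq_of_forall_edge (hG : G.IsConnected) {f : V → ℚ}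
    (hf : ∀ e, f (G.tgt e) - f (G.src e) = 0) (x y : V) : f x = f y :=
  eq_of_joined (fun e _ => (sub_eq_zero.1 (hf e)).symm) (hG x y)

theorem IsConnected.coboundary_injective (hG : G.IsConnected) (hL : G.IsEquivariant L) (x : V) :
    Injective (coboundary L G x) := by
  rw [injective_iff_map_eq_zero]
  rintro ⟨⟨f, φ⟩, hf⟩ h
  have hf_zero (v : V) : f v = 0 := (hG.eq_of_forall_edge (fun e =>
    (hL.coboundary_mk x ⟨(f, φ), hf⟩ e).symm.trans
      (congrFun (congrArg Prod.fst h) ⟦e⟧)) v x).trans (congrArg Prod.snd h)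
  refine Subtype.ext (Prod.ext (funext hf_zero) (AddMonoidHom.ext fun g => ?_))
  have := hf g.toMul x
  simp only [hf_zero, zero_add] at this
  exact this.symm

theorem IsConnected.exists_mem_equivariantFunctions (hG : G.IsConnected)
    (hL : G.IsEquivariant L) {f : V → ℚ}
    (hf : ∀ (g : L) e, f (G.tgt (g • e)) - f (G.src (g • e)) = f (G.tgt e) - f (G.src e)) :
    ∃ φ, (f, φ) ∈ equivariantFunctions L V := by
  have hconst (g : L) (x y : V) : f (g • x) - f x = f (g • y) - f y :=
    hG.eq_of_forall_edge (f := fun v => f (g • v) - f v) (fun e => by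
      have := hf g e
      rw [(hL g).src_map, (hL g).tgt_map] at this
      linarith) x y
  rcases isEmpty_or_nonempty V with _ | ⟨⟨x⟩⟩
  · exact ⟨0, fun _ v => isEmptyElim v⟩
  refine ⟨AddMonoidHom.mk' (fun g => f (g.toMul • x) - f x) fun g h => ?_, fun g v => ?_⟩
  · have := hconst g.toMul (h.toMul • x) x
    simp only [toMul_add, mul_smul]
    linarith
  · have := hconst g v x
    simp only [AddMonoidHom.mk'_apply, toMul_ofMul]
    linarith

/-- The group `L` acts by automorphisms on the graph `G`, which is a tree. -/
structure IsTreeAction (L : Type*) [Group L] [MulAction L V] [MulAction L E]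
    (G : Multidigraph V E) : Prop where
  forest : G.IsForest
  connected : G.IsConnected
  equivariant : G.IsEquivariant L

theorem IsTreeAction.coboundary_surjective (hG : G.IsTreeAction L) (x : V) :
    Surjective (coboundary L G x) := by
  rintro ⟨c, a⟩
  obtain ⟨f₀, hf₀⟩ := hG.forest fun e => c ⟦e⟧
  let f : V → ℚ := fun v => f₀ v - f₀ x + a
  have hf (e : E) : f (G.tgt e) - f (G.src e) = c ⟦e⟧ := by
    rw [← hf₀ e]
    ring
  obtain ⟨φ, hφ⟩ := hG.connected.exists_mem_equivariantFunctions hG.equivariant (f := f)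
    fun g e => by rw [hf, hf, mk_smul_eq_mk]
  refine ⟨⟨(f, φ), hφ⟩, Prod.ext (funext fun q => ?_) ?_⟩
  · exact (hf q.out).trans (congrArg c (Quotient.out_eq q))
  · exact (congrArg (· + a) (sub_self (f₀ x))).trans (zero_add a)

variable [IsCancelSMul L V] [Nonempty V]

theorem IsTreeAction.nonempty_linearEquiv (hG : G.IsTreeAction L) :
    Nonempty (((orbitRel.Quotient L V → ℚ) × FirstCohomology L) ≃ₗ[ℚ]
      ((orbitRel.Quotient L E → ℚ) × ℚ)) := by
  obtain ⟨x⟩ := ‹Nonempty V›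
  exact ⟨(LinearEquiv.ofBijective (valuesOnOrbits L V)
    ⟨valuesOnOrbits_injective, valuesOnOrbits_surjective⟩).symm.trans
      (LinearEquiv.ofBijective (coboundary L G x)
        ⟨hG.connected.coboundary_injective hG.equivariant x, hG.coboundary_surjective x⟩)⟩

theorem IsTreeAction.finite_firstCohomology [Finite (orbitRel.Quotient L E)]
    (hG : G.IsTreeAction L) : Module.Finite ℚ (FirstCohomology L) := by
  obtain ⟨equiv⟩ := hG.nonempty_linearEquiv
  exact .of_surjective ((LinearMap.snd ℚ (orbitRel.Quotient L V → ℚ) _).comp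
    equiv.symm.toLinearMap) (Prod.snd_surjective.comp equiv.symm.surjective)

variable [Finite (orbitRel.Quotient L V)]

theorem IsTreeAction.finite_edgeOrbits [Module.Finite ℚ (FirstCohomology L)]
    (hG : G.IsTreeAction L) : Finite (orbitRel.Quotient L E) := by
  obtain ⟨equiv⟩ := hG.nonempty_linearEquiv
  have : Module.Finite ℚ (orbitRel.Quotient L E → ℚ) := .of_surjective
    ((LinearMap.fst ℚ _ ℚ).comp equiv.toLinearMap) (Prod.fst_surjective.comp equiv.surjective)
  exact finite_of_moduleFinite_fun (K := ℚ)

variable [Finite (orbitRel.Quotient L E)]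

theorem IsTreeAction.firstBetti_add_card (hG : G.IsTreeAction L) :
    firstBetti L + Nat.card (orbitRel.Quotient L V) = Nat.card (orbitRel.Quotient L E) + 1 := by
  obtain ⟨equiv⟩ := hG.nonempty_linearEquiv
  have := hG.finite_firstCohomology
  have := Fintype.ofFinite (orbitRel.Quotient L E)
  have := Fintype.ofFinite (orbitRel.Quotient L V)
  have h := equiv.finrank_eq
  rw [Module.finrank_prod, Module.finrank_prod, Module.finrank_fintype_fun_eq_card,
    Module.finrank_fintype_fun_eq_card, Module.finrank_self, add_comm] at h
  rwa [Nat.card_eq_fintype_card, Nat.card_eq_fintype_card]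

variable [LinearOrder V] [LinearOrder E] [CovariantClass L V HSMul.hSMul LT.lt]
  [CovariantClass L E HSMul.hSMul LT.lt]

theorem IsTreeAction.firstBetti_le (hG : G.IsTreeAction L) :
    firstBetti L ≤ (G.essentialOrbits L).ncard + 1 := by
  have heuler := hG.firstBetti_add_card
  have hcard := hG.forest.card_edgeOrbits_le hG.equivariant
  lia

theorem IsTreeAction.firstBetti_eq [Nontrivial L] (hG : G.IsTreeAction L) :
    firstBetti L = (G.essentialOrbits L).ncard + 1 := by
  have heuler := hG.firstBetti_add_card
  have hcard := hG.connected.le_card_edgeOrbits hG.equivariant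
  have hle := hG.firstBetti_le
  lia

end EulerCharacteristic

end Multidigraph

section FreeGroupCohomology

variable {L : Type*} [Group L] {ι : Type*}

/-- Evaluation of homomorphisms at a family of group elements. -/
def evalFamily (b : ι → L) : FirstCohomology L →ₗ[ℚ] (ι → ℚ) where
  toFun φ i := φ (.ofMul (b i))
  map_add' _ _ := rfl
  map_smul' _ _ := rfl

theorem evalFamily_injective {b : ι → L} (hb : Subgroup.closure (range b) = ⊤) :
    Injective (evalFamily b) := by
  intro φ ψ h
  refine AddMonoidHom.toMultiplicativeRight.injective (MonoidHom.eq_of_eqOn_dense hb ?_)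
  rintro _ ⟨i, rfl⟩
  exact congrArg Multiplicative.ofAdd (congrFun h i)

theorem evalFamily_surjective (b : FreeGroupBasis ι L) : Surjective (evalFamily b) := fun f =>
  ⟨AddMonoidHom.toMultiplicativeRight.symm (b.lift fun i => .ofAdd (f i)), funext fun i =>
    congrArg Multiplicative.toAdd
      (congrFun (b.lift.symm_apply_apply fun i => Multiplicative.ofAdd (f i)) i)⟩

theorem closure_range_freeGroupBasis (b : FreeGroupBasis ι L) :
    Subgroup.closure (range b) = ⊤ := by
  have hmap := congrArg (Subgroup.map b.repr.symm.toMonoidHom) (FreeGroup.closure_range_of ι)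
  rwa [MonoidHom.map_closure, ← range_comp, ← MonoidHom.range_eq_map,
    MonoidHom.range_eq_top.2 b.repr.symm.surjective] at hmap

theorem finite_firstCohomology_of_fg [Group.FG L] : Module.Finite ℚ (FirstCohomology L) := by
  obtain ⟨S, -, hS⟩ := Group.rank_spec L
  exact .of_injective (evalFamily (Subtype.val : S → L))
    (evalFamily_injective (by rwa [Subtype.range_coe]))

theorem finite_generators_of_finite_firstCohomology [IsFreeGroup L]
    [Module.Finite ℚ (FirstCohomology L)] : Finite (IsFreeGroup.Generators L) :=
  have : Module.Finite ℚ (IsFreeGroup.Generators L → ℚ) :=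
    .of_surjective _ (evalFamily_surjective (IsFreeGroup.basis L))
  finite_of_moduleFinite_fun (K := ℚ)

theorem fg_of_finite_firstCohomology [IsFreeGroup L] [Module.Finite ℚ (FirstCohomology L)] :
    Group.FG L :=
  have := finite_generators_of_finite_firstCohomology (L := L)
  Group.fg_iff.2 ⟨_, closure_range_freeGroupBasis (IsFreeGroup.basis L), finite_range _⟩

theorem firstBetti_le_rank [Group.FG L] : firstBetti L ≤ Group.rank L := by
  obtain ⟨S, hcard, hS⟩ := Group.rank_spec L
  calc firstBetti L ≤ Module.finrank ℚ (S → ℚ) := LinearMap.finrank_le_finrank_of_injective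
        (evalFamily_injective (b := (Subtype.val : S → L)) (by rwa [Subtype.range_coe]))
    _ = Group.rank L := by rw [Module.finrank_fintype_fun_eq_card, Fintype.card_coe, hcard]

theorem rank_eq_firstBetti [IsFreeGroup L] [Group.FG L] : Group.rank L = firstBetti L := by
  classical
  refine le_antisymm ?_ firstBetti_le_rank
  have := finite_firstCohomology_of_fg (L := L)
  have := finite_generators_of_finite_firstCohomology (L := L)
  have := Fintype.ofFinite (IsFreeGroup.Generators L)
  let b := IsFreeGroup.basis L
  have hgen : Subgroup.closure ((Finset.univ.image b : Finset L) : Set L) = ⊤ := by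
    rw [Finset.coe_image, Finset.coe_univ, image_univ, closure_range_freeGroupBasis]
  calc Group.rank L ≤ (Finset.univ.image b).card := Group.rank_le hgen
    _ ≤ Module.finrank ℚ (IsFreeGroup.Generators L → ℚ) := by
        rw [Module.finrank_fintype_fun_eq_card]
        exact Finset.card_image_le
    _ ≤ firstBetti L := LinearMap.finrank_le_finrank_of_surjective (evalFamily_surjective b)

end FreeGroupCohomology

/-! ### Cofinite subtrees -/

section Translates

variable {L V : Type*} [Group L] [MulAction L V]

/-- The set of all translates of points of `P`. -/
def translates (L : Type*) [Group L] [MulAction L V] (P : Set V) : SubMulAction L V where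
  carrier := ⋃ g : L, g • P
  smul_mem' g x hx := by
    obtain ⟨h, hx⟩ := mem_iUnion.1 hx
    exact mem_iUnion.2 ⟨g * h, mul_smul g h P ▸ smul_mem_smul_set hx⟩

theorem smul_set_subset_translates (g : L) (P : Set V) : g • P ⊆ translates L P :=
  subset_iUnion (fun g : L => g • P) g

theorem finite_orbits_translates {P : Set V} (hP : P.Finite) :
    Finite (orbitRel.Quotient L (translates L P)) := by
  have := hP.to_subtype
  refine .of_surjective (α := P)
    (fun p => ⟦⟨p, smul_set_subset_translates (1 : L) P (by simp only [one_smul, p.2])⟩⟧) ?_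
  refine Quotient.ind fun ⟨x, hx⟩ => ?_
  obtain ⟨g, p, hp, rfl⟩ := mem_iUnion.1 hx
  exact ⟨⟨p, hp⟩, (orbit_mk_eq_iff.2 ⟨g, rfl⟩).symm⟩

end Translates

namespace Multidigraph

section CofiniteSubgraph

variable {V E : Type*} {G : Multidigraph V E} {X Y : Set V} {v : V}

theorem spanned_mono (h : X ⊆ Y) : G.spanned X ⊆ G.spanned Y :=
  fun _ he => ⟨h he.1, h he.2⟩

theorem ConnectedOn.of_base (h : ∀ x ∈ X, G.joined (G.spanned X) v x) : G.ConnectedOn X :=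
  fun x hx y hy => (G.joined _).trans ((G.joined _).symm (h x hx)) (h y hy)

theorem ConnectedOn.union (hX : G.ConnectedOn X) (hY : G.ConnectedOn Y) (hvX : v ∈ X)
    (hvY : v ∈ Y) : G.ConnectedOn (X ∪ Y) := by
  refine .of_base (v := v) ?_
  rintro x (hx | hx)
  · exact joined_mono (spanned_mono subset_union_left) (hX v hvX x hx)
  · exact joined_mono (spanned_mono subset_union_right) (hY v hvY x hx)

theorem connectedOn_singleton (v : V) : G.ConnectedOn {v} := by
  rintro x rfl y rfl
  exact (G.joined _).refl y

theorem connectedOn_ends (e : E) : G.ConnectedOn {G.src e, G.tgt e} := by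
  refine .of_base (v := G.src e) ?_
  rintro x (rfl | rfl)
  · exact (G.joined _).refl _
  · exact joined_src_tgt ⟨.inl rfl, .inr rfl⟩

theorem IsConnected.exists_finite_connectedOn_pair (hG : G.IsConnected) (v w : V) :
    ∃ P : Set V, P.Finite ∧ G.ConnectedOn P ∧ v ∈ P ∧ w ∈ P := by
  let r : Setoid V :=
    { r := fun v w => ∃ P : Set V, P.Finite ∧ G.ConnectedOn P ∧ v ∈ P ∧ w ∈ P
      iseqv :=
        { refl := fun v => ⟨{v}, finite_singleton v, connectedOn_singleton v, rfl, rfl⟩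
          symm := fun ⟨P, hP, hconn, hv, hw⟩ => ⟨P, hP, hconn, hw, hv⟩
          trans := fun ⟨P, hP, hconn, hu, hv⟩ ⟨Q, hQ, hconn', hv', hw⟩ =>
            ⟨P ∪ Q, hP.union hQ, hconn.union hconn' hv hv', .inl hu, .inr hw⟩ } }
  exact joined_le (r := r) (fun e _ => ⟨_, toFinite _, connectedOn_ends e, .inl rfl, .inr rfl⟩)
    (hG v w)

theorem IsConnected.exists_finite_connectedOn (hG : G.IsConnected) (v : V) {S : Set V}
    (hS : S.Finite) : ∃ P : Set V, P.Finite ∧ G.ConnectedOn P ∧ v ∈ P ∧ S ⊆ P := by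
  induction S, hS using Set.Finite.induction_on with
  | empty => exact ⟨{v}, finite_singleton v, connectedOn_singleton v, rfl, empty_subset _⟩
  | @insert w S _ _ ih =>
    obtain ⟨P, hP, hconn, hv, hSP⟩ := ih
    obtain ⟨Q, hQ, hconn', hv', hw⟩ := hG.exists_finite_connectedOn_pair v w
    exact ⟨P ∪ Q, hP.union hQ, hconn.union hconn' hv hv', .inl hv,
      insert_subset (.inr hw) (hSP.trans subset_union_left)⟩

variable {L : Type*} [Group L] [MulAction L V] [MulAction L E]

theorem IsEquivariant.joined_smul (hL : G.IsEquivariant L) {X : SubMulAction L V} (g : L)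
    {x y : V} (h : G.joined (G.spanned X) x y) : G.joined (G.spanned X) (g • x) (g • y) := by
  refine (hL g).joined_map (fun e he => ?_) h
  exact ⟨(hL g).src_map e ▸ X.smul_mem g he.1, (hL g).tgt_map e ▸ X.smul_mem g he.2⟩

theorem ConnectedOn.translates_of_closure_eq_top {P : Set V} (hP : G.ConnectedOn P)
    (hL : G.IsEquivariant L) (hv : v ∈ P) {S : Set L} (hS : Subgroup.closure S = ⊤)
    (hSP : ∀ s ∈ S, s • v ∈ P) :
    G.ConnectedOn (translates L P) := by
  let r := G.joined (G.spanned (translates L P))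
  have hbase {x : V} (hx : x ∈ P) : r v x :=
    joined_mono (spanned_mono fun y hy => smul_set_subset_translates (1 : L) P
      (by rwa [one_smul])) (hP v hv x hx)
  have horbit (g : L) : r v (g • v) := by
    induction hS ▸ Subgroup.mem_top g using Subgroup.closure_induction with
    | mem s hs => exact hbase (hSP s hs)
    | one => rw [one_smul]
    | mul g h _ _ hg hh => exact r.trans hg (mul_smul g h v ▸ hL.joined_smul g hh)
    | inv g _ hg =>
      have := hL.joined_smul g⁻¹ hg
      rw [inv_smul_smul] at this
      exact r.symm this
  refine .of_base (v := v) fun x hx => ?_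
  obtain ⟨g, p, hp, rfl⟩ := mem_iUnion.1 hx
  exact r.trans (horbit g) (hL.joined_smul g (hbase hp))

theorem IsConnected.exists_cofinite_connectedOn [Group.FG L] (hG : G.IsConnected)
    (hL : G.IsEquivariant L) (v : V) : ∃ X : SubMulAction L V,
      v ∈ X ∧ G.ConnectedOn X ∧ Finite (orbitRel.Quotient L X) := by
  obtain ⟨S, hS, hSfin⟩ := Group.fg_iff.1 ‹Group.FG L›
  obtain ⟨P, hPfin, hP, hv, hSP⟩ := hG.exists_finite_connectedOn v (hSfin.image (· • v))
  refine ⟨translates L P, smul_set_subset_translates (1 : L) P (by rwa [one_smul]), ?_,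
    finite_orbits_translates hPfin⟩
  exact hP.translates_of_closure_eq_top hL hv hS fun s hs => hSP (mem_image_of_mem _ hs)

end CofiniteSubgraph

section Induced

variable {V E L : Type*} {G : Multidigraph V E} [Group L] [MulAction L V] [MulAction L E]

/-- The edges of the full subgraph on an invariant set of vertices, as an invariant set. -/
def IsEquivariant.spannedEdges (hL : G.IsEquivariant L) (X : SubMulAction L V) :
    SubMulAction L E where
  carrier := G.spanned X
  smul_mem' g e he :=
    ⟨(hL g).src_map e ▸ X.smul_mem g he.1, (hL g).tgt_map e ▸ X.smul_mem g he.2⟩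

/-- The full subgraph on an invariant set of vertices. -/
def IsEquivariant.induce (hL : G.IsEquivariant L) (X : SubMulAction L V) :
    Multidigraph X (hL.spannedEdges X) where
  src e := ⟨G.src e, e.2.1⟩
  tgt e := ⟨G.tgt e, e.2.2⟩

variable (hL : G.IsEquivariant L) {X : SubMulAction L V}
include hL

theorem IsEquivariant.induce_isEquivariant : (hL.induce X).IsEquivariant L := fun g =>
  ⟨fun e => Subtype.ext ((hL g).src_map e), fun e => Subtype.ext ((hL g).tgt_map e)⟩

theorem IsForest.induce (hG : G.IsForest) : (hL.induce X).IsForest := by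
  classical
  intro c
  obtain ⟨f, hf⟩ := hG fun e => if he : e ∈ hL.spannedEdges X then c ⟨e, he⟩ else 0
  exact ⟨fun x => f x, fun e => (hf e).trans (dif_pos e.2)⟩

theorem ConnectedOn.induce (hX : G.ConnectedOn X) : (hL.induce X).IsConnected := by
  intro x y
  let component : Set V := Subtype.val '' (hL.induce X).component univ x
  have hsub : G.component (G.spanned X) x ⊆ component := by
    refine component_subset (mem_image_of_mem _ mem_component_self) fun e he => ?_
    have hiff := src_mem_component_iff (G := hL.induce X) (x := x) (mem_univ ⟨e, he⟩)
    rwa [← Subtype.val_injective.mem_set_image (s := (hL.induce X).component univ x),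
      ← Subtype.val_injective.mem_set_image (s := (hL.induce X).component univ x)] at hiff
  obtain ⟨z, hz, hzy⟩ := hsub (hX x x.2 y y.2)
  exact Subtype.ext hzy ▸ hz

theorem IsForest.isTreeAction_induce (hG : G.IsForest) (hX : G.ConnectedOn X) :
    (hL.induce X).IsTreeAction L :=
  ⟨hG.induce hL, hX.induce hL, hL.induce_isEquivariant⟩

end Induced

end Multidigraph

/-! ### Intersections of subgroups -/

instance covariantClass_subgroup_smul_lt {Γ α : Type*} [Group Γ] [MulAction Γ α] [LT α]
    [CovariantClass Γ α HSMul.hSMul LT.lt] (H : Subgroup Γ) :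
    CovariantClass H α HSMul.hSMul LT.lt :=
  ⟨fun g _ _ h => CovariantClass.elim (μ := HSMul.hSMul) (g : Γ) h⟩

instance covariantClass_subMulAction_smul_lt {Γ α : Type*} [Group Γ] [MulAction Γ α] [LT α]
    [CovariantClass Γ α HSMul.hSMul LT.lt] (X : SubMulAction Γ α) :
    CovariantClass Γ X HSMul.hSMul LT.lt :=
  ⟨fun g _ _ h => CovariantClass.elim (μ := HSMul.hSMul) (M := Γ) (N := α) (r := LT.lt) g h⟩

section OrbitPairs

variable {Γ α : Type*} [Group Γ] [MulAction Γ α] {H K : Subgroup Γ}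

/-- The intersection of an `H`-invariant and a `K`-invariant set, as an `H ⊓ K`-invariant set. -/
def interAction (X : SubMulAction H α) (Y : SubMulAction K α) :
    SubMulAction (H ⊓ K : Subgroup Γ) α where
  carrier := X ∩ Y
  smul_mem' g _ h := ⟨X.smul_mem ⟨g, g.2.1⟩ h.1, Y.smul_mem ⟨g, g.2.2⟩ h.2⟩

variable {X : SubMulAction H α} {Y : SubMulAction K α} {Z : SubMulAction (H ⊓ K : Subgroup Γ) α}

/-- The pair formed by the `H`-orbit and the `K`-orbit containing a given `H ⊓ K`-orbit. -/
def orbitPair (hZX : (Z : Set α) ⊆ X) (hZY : (Z : Set α) ⊆ Y)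
    (q : orbitRel.Quotient (H ⊓ K : Subgroup Γ) Z) :
    orbitRel.Quotient H X × orbitRel.Quotient K Y :=
  Quotient.liftOn q (fun z => (⟦⟨z, hZX z.2⟩⟧, ⟦⟨z, hZY z.2⟩⟧)) <| by
    rintro _ w ⟨g, rfl⟩
    exact Prod.ext (orbit_mk_eq_iff.2 ⟨⟨g, g.2.1⟩, rfl⟩) (orbit_mk_eq_iff.2 ⟨⟨g, g.2.2⟩, rfl⟩)

theorem orbitPair_injective [IsCancelSMul Γ α] (hZX : (Z : Set α) ⊆ X) (hZY : (Z : Set α) ⊆ Y) :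
    Injective (orbitPair hZX hZY) := by
  refine Quotient.ind₂ fun z w h => ?_
  obtain ⟨g, hg⟩ := orbit_mk_eq_iff.1 (congrArg Prod.fst h)
  obtain ⟨k, hk⟩ := orbit_mk_eq_iff.1 (congrArg Prod.snd h)
  have hgz : (g : Γ) • (w : α) = z := congrArg Subtype.val hg
  have hkz : (k : Γ) • (w : α) = z := congrArg Subtype.val hk
  have hgk : (g : Γ) = k := IsCancelSMul.right_cancel _ _ (w : α) (hgz.trans hkz.symm)
  exact orbit_mk_eq_iff.2 ⟨⟨g, g.2, hgk ▸ k.2⟩, Subtype.ext hgz⟩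

theorem finite_orbits_of_subset [IsCancelSMul Γ α] [Finite (orbitRel.Quotient H X)]
    [Finite (orbitRel.Quotient K Y)] (hZX : (Z : Set α) ⊆ X) (hZY : (Z : Set α) ⊆ Y) :
    Finite (orbitRel.Quotient (H ⊓ K : Subgroup Γ) Z) :=
  .of_injective _ (orbitPair_injective hZX hZY)

end OrbitPairs

namespace Multidigraph

variable {Γ V E : Type*} [Group Γ] [MulAction Γ V] [MulAction Γ E] {G : Multidigraph V E}

theorem IsEquivariant.subgroup (hG : G.IsEquivariant Γ) (H : Subgroup Γ) : G.IsEquivariant H :=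
  fun g => hG g

theorem IsEquivariant.isCancelSMul_edges [IsCancelSMul Γ V] (hG : G.IsEquivariant Γ) :
    IsCancelSMul Γ E :=
  isCancelSMul_iff_eq_one_of_smul_eq.2 fun g e he =>
    IsCancelSMul.eq_one_of_smul (x := G.src e) (((hG g).src_map e).symm.trans (congrArg G.src he))

variable {H K : Subgroup Γ}

theorem IsEquivariant.spannedEdges_inter_subset_left (hG : G.IsEquivariant Γ)
    (X : SubMulAction H V) (Y : SubMulAction K V) :
    ((hG.subgroup _).spannedEdges (interAction X Y) : Set E) ⊆ (hG.subgroup H).spannedEdges X :=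
  fun _ he => ⟨he.1.1, he.2.1⟩

theorem IsEquivariant.spannedEdges_inter_subset_right (hG : G.IsEquivariant Γ)
    (X : SubMulAction H V) (Y : SubMulAction K V) :
    ((hG.subgroup _).spannedEdges (interAction X Y) : Set E) ⊆ (hG.subgroup K).spannedEdges Y :=
  fun _ he => ⟨he.1.2, he.2.2⟩

variable [IsCancelSMul Γ V] {X : SubMulAction H V} {Y : SubMulAction K V}

theorem IsEquivariant.ncard_essentialOrbits_inter_le [LinearOrder E] (hG : G.IsEquivariant Γ)
    (hX : ((hG.subgroup H).induce X).essentialOrbits H |>.Finite)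
    (hY : ((hG.subgroup K).induce Y).essentialOrbits K |>.Finite) :
    (((hG.subgroup _).induce (interAction X Y)).essentialOrbits (H ⊓ K : Subgroup Γ)).ncard ≤
      (((hG.subgroup H).induce X).essentialOrbits H).ncard *
        (((hG.subgroup K).induce Y).essentialOrbits K).ncard := by
  have := hG.isCancelSMul_edges
  have hsubX := hG.spannedEdges_inter_subset_left X Y
  have hsubY := hG.spannedEdges_inter_subset_right X Y
  rw [← ncard_prod]
  refine ncard_le_ncard_of_injOn (orbitPair hsubX hsubY) ?_ (orbitPair_injective _ _).injOn
    (hX.prod hY)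
  rintro _ ⟨e, he, rfl⟩
  exact ⟨⟨_, he.map (φ := inclusion inter_subset_left) (ψ := inclusion hsubX)
      ⟨fun _ => rfl, fun _ => rfl⟩ (inclusion_injective _) (fun _ _ h => h), rfl⟩,
    ⟨_, he.map (φ := inclusion inter_subset_right) (ψ := inclusion hsubY)
      ⟨fun _ => rfl, fun _ => rfl⟩ (inclusion_injective _) (fun _ _ h => h), rfl⟩⟩

theorem IsEquivariant.finite_edgeOrbits_inter (hG : G.IsEquivariant Γ)
    [Finite (orbitRel.Quotient H ((hG.subgroup H).spannedEdges X))]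
    [Finite (orbitRel.Quotient K ((hG.subgroup K).spannedEdges Y))] :
    Finite (orbitRel.Quotient (H ⊓ K : Subgroup Γ)
      ((hG.subgroup _).spannedEdges (interAction X Y))) :=
  have := hG.isCancelSMul_edges
  finite_orbits_of_subset (hG.spannedEdges_inter_subset_left X Y)
    (hG.spannedEdges_inter_subset_right X Y)

variable [LinearOrder V] [LinearOrder E] [CovariantClass Γ V HSMul.hSMul LT.lt]
  [CovariantClass Γ E HSMul.hSMul LT.lt] [Nontrivial H] [Nontrivial K]
  [Finite (orbitRel.Quotient H X)] [Finite (orbitRel.Quotient K Y)]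
  [Module.Finite ℚ (FirstCohomology H)] [Module.Finite ℚ (FirstCohomology K)]

theorem IsForest.finite_firstCohomology_inf_and_firstBetti_le (hG : G.IsForest)
    (hΓ : G.IsEquivariant Γ) (hX : G.ConnectedOn X) (hY : G.ConnectedOn Y)
    (hne : ((X : Set V) ∩ Y).Nonempty) :
    Module.Finite ℚ (FirstCohomology (H ⊓ K : Subgroup Γ)) ∧
      (firstBetti (H ⊓ K : Subgroup Γ) : ℚ) - 1 ≤
        ((firstBetti H : ℚ) - 1) * ((firstBetti K : ℚ) - 1) := by
  have : Nonempty X := hne.left.to_subtype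
  have : Nonempty Y := hne.right.to_subtype
  have : Nonempty (interAction X Y) := hne.to_subtype
  have hXtree := hG.isTreeAction_induce (hΓ.subgroup H) hX
  have hYtree := hG.isTreeAction_induce (hΓ.subgroup K) hY
  have hZtree := hG.isTreeAction_induce (hΓ.subgroup _) (X := interAction X Y)
    (hG.connectedOn_inter hX hY)
  have := hXtree.finite_edgeOrbits
  have := hYtree.finite_edgeOrbits
  have := hΓ.finite_edgeOrbits_inter (X := X) (Y := Y)
  have : Finite (orbitRel.Quotient (H ⊓ K : Subgroup Γ) (interAction X Y)) :=
    finite_orbits_of_subset inter_subset_left inter_subset_right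
  refine ⟨hZtree.finite_firstCohomology, ?_⟩
  have hle := hZtree.firstBetti_le.trans
    (Nat.add_le_add_right (hΓ.ncard_essentialOrbits_inter_le (toFinite _) (toFinite _)) 1)
  rw [hXtree.firstBetti_eq, hYtree.firstBetti_eq, Nat.cast_add_one, Nat.cast_add_one,
    add_sub_cancel_right, add_sub_cancel_right, sub_le_iff_le_add]
  exact_mod_cast hle

end Multidigraph

/-! ### Left orders on free groups -/

section LeftOrder

theorem exists_orderIso_extending {α β : Type*} [LinearOrder α] [LinearOrder β] [Countable α]
    [DenselyOrdered α] [NoMinOrder α] [NoMaxOrder α] [Nonempty α] [Countable β]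
    [DenselyOrdered β] [NoMinOrder β] [NoMaxOrder β] [Nonempty β] (p : Order.PartialIso α β) :
    ∃ f : α ≃o β, ∀ x ∈ p.val, f x.1 = x.2 := by
  cases nonempty_encodable α
  cases nonempty_encodable β
  let cofinals : α ⊕ β → Order.Cofinal (Order.PartialIso α β) :=
    Sum.elim (Order.PartialIso.definedAtLeft β) (Order.PartialIso.definedAtRight α)
  let I := Order.idealOfCofinals p cofinals
  let F a := Order.PartialIso.funOfIdeal a I
    (Order.cofinal_meets_idealOfCofinals p cofinals (Sum.inl a))
  let G b := Order.PartialIso.invOfIdeal b I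
    (Order.cofinal_meets_idealOfCofinals p cofinals (Sum.inr b))
  have cmp_eq : ∀ x y, (∃ q ∈ I, x ∈ q.val) → (∃ q ∈ I, y ∈ q.val) →
      cmp x.1 y.1 = cmp x.2 y.2 := by
    rintro x y ⟨q, hq, hx⟩ ⟨r, hr, hy⟩
    obtain ⟨m, -, hqm, hrm⟩ := I.directed q hq r hr
    exact m.prop x (hqm hx) y (hrm hy)
  refine ⟨.ofCmpEqCmp (fun a => (F a).val) (fun b => (G b).val)
    fun a b => cmp_eq _ _ (F a).prop (G b).prop, fun x hx => ?_⟩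
  have := cmp_eq (x.1, (F x.1).val) x (F x.1).prop ⟨p, Order.mem_idealOfCofinals p cofinals, hx⟩
  exact (cmp_eq_eq_iff _ _).1 (this.symm.trans (cmp_self_eq_eq _))

variable {ι : Type*}

/-- The letters of a word `w`, the last one acting first, are to move the point `w.length` of `ℚ`
down to `0` in unit steps. This is the step of the `i`-th letter, from `i + 1` to `i`, as a pair of
argument and value of the underlying generator: it is reversed if the letter is an inverse. -/
def wordStep (w : List (ι × Bool)) (i : Fin w.length) : ℚ × ℚ :=
  if (w.get i).2 then ((i : ℚ) + 1, (i : ℚ)) else ((i : ℚ), (i : ℚ) + 1)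

theorem wordStep_lt_wordStep {w : List (ι × Bool)} (hw : FreeGroup.IsReduced w)
    {i j : Fin w.length} (hij : i < j) (h : (w.get i).1 = (w.get j).1) :
    (wordStep w i).1 < (wordStep w j).1 ∧ (wordStep w i).2 < (wordStep w j).2 := by
  rcases (Nat.succ_le_of_lt (Fin.lt_def.1 hij)).lt_or_eq with hlt | heq
  · have hlt' : (i : ℚ) + 1 < j := mod_cast hlt
    unfold wordStep
    split_ifs <;> constructor <;> dsimp only <;> linarith
  · have hi : i + 1 < w.length := heq.trans_lt j.2
    obtain rfl : j = ⟨i + 1, hi⟩ := Fin.ext heq.symm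
    have hsign : (w.get i).2 = (w.get ⟨i + 1, hi⟩).2 := List.isChain_iff_getElem.1 hw i hi h
    simp only [wordStep, ← hsign, Nat.cast_add_one]
    split_ifs <;> constructor <;> dsimp only <;> linarith

open Classical in
/-- The finite part of the graph of the generator `a` that is prescribed by `wordStep w`. -/
noncomputable def letterIso {w : List (ι × Bool)} (hw : FreeGroup.IsReduced w) (a : ι) :
    Order.PartialIso ℚ ℚ :=
  ⟨Finset.univ.image fun i : {i : Fin w.length // (w.get i).1 = a} => wordStep w i, by
    have hfst : StrictMono fun i : {i : Fin w.length // (w.get i).1 = a} => (wordStep w i).1 :=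
      fun i j hij => (wordStep_lt_wordStep hw hij (i.2.trans j.2.symm)).1
    have hsnd : StrictMono fun i : {i : Fin w.length // (w.get i).1 = a} => (wordStep w i).2 :=
      fun i j hij => (wordStep_lt_wordStep hw hij (i.2.trans j.2.symm)).2
    simp only [Finset.mem_image, Finset.mem_univ, true_and]
    rintro _ ⟨i, rfl⟩ _ ⟨j, rfl⟩
    exact (hfst.cmp_map_eq i j).trans (hsnd.cmp_map_eq i j).symm⟩

theorem lift_mk_singleton_apply_wordStep {w : List (ι × Bool)} {f : ι → ℚ ≃o ℚ}
    {i : Fin w.length} (hf : f (w.get i).1 (wordStep w i).1 = (wordStep w i).2) :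
    FreeGroup.lift f (.mk [w.get i]) ((i : ℚ) + 1) = i := by
  unfold wordStep at hf
  obtain ⟨⟨a, s⟩, hw⟩ : ∃ l, w.get i = l := ⟨_, rfl⟩
  rw [hw] at hf ⊢
  cases s
  · rw [show FreeGroup.lift f (.mk [(a, false)]) = (f a)⁻¹ by simp]
    exact (f a).symm_apply_eq.2 hf.symm
  · rw [show FreeGroup.lift f (.mk [(a, true)]) = f a by simp]
    exact hf

theorem lift_mk_take_apply {w : List (ι × Bool)} {f : ι → ℚ ≃o ℚ}
    (hf : ∀ i, f (w.get i).1 (wordStep w i).1 = (wordStep w i).2) :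
    ∀ n ≤ w.length, FreeGroup.lift f (.mk (w.take n)) (n : ℚ) = 0
  | 0, _ => by simp [← FreeGroup.one_eq_mk]
  | n + 1, hn => by
    rw [List.take_succ_eq_append_getElem hn, ← FreeGroup.mul_mk, map_mul, RelIso.mul_apply,
      Nat.cast_add_one]
    exact (congrArg _ (lift_mk_singleton_apply_wordStep (hf ⟨n, hn⟩))).trans
      (lift_mk_take_apply hf n (Nat.le_of_succ_le hn))

theorem exists_orderIso_action_ne {g : FreeGroup ι} (hg : g ≠ 1) :
    ∃ (φ : FreeGroup ι →* (ℚ ≃o ℚ)) (q : ℚ), φ g q ≠ q := by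
  classical
  choose f hf using fun a => exists_orderIso_extending (letterIso g.isReduced_toWord a)
  refine ⟨FreeGroup.lift f, g.toWord.length, ?_⟩
  have hzero := lift_mk_take_apply (f := f) (fun i => hf _ _ (Finset.mem_image.2
    ⟨⟨i, rfl⟩, Finset.mem_univ _, rfl⟩)) g.toWord.length le_rfl
  rw [List.take_length, FreeGroup.mk_toWord] at hzero
  rw [hzero]
  exact_mod_cast (List.length_pos_iff.2 (mt FreeGroup.toWord_eq_nil_iff.1 hg)).ne

theorem exists_mulLeftStrictMono_of_orderIso_actions {L α : Type*} [Group L] [LinearOrder α]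
    (h : ∀ g : L, g ≠ 1 → ∃ (φ : L →* (α ≃o α)) (x : α), φ g x ≠ x) :
    ∃ _ : LinearOrder L, MulLeftStrictMono L := by
  classical
  let W := {g : L // g ≠ 1}
  let _ : LinearOrder W := linearOrderOfSTO WellOrderingRel
  have : WellFoundedLT W := ⟨WellOrderingRel.isWellOrder.wf⟩
  choose φ x hx using fun w : W => h w w.2
  let Φ (g : L) : Lex (W → α) := toLex fun w => φ w g (x w)
  have hΦ : Injective Φ := fun a b hab => by
    by_contra hne
    let w : W := ⟨a⁻¹ * b, mt inv_mul_eq_one.1 hne⟩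
    have hw : φ w a (x w) = φ w b (x w) := congrFun hab w
    refine hx w ?_
    rw [map_mul, map_inv, RelIso.mul_apply, ← hw]
    exact (φ w a).symm_apply_apply _
  have hmul : ∀ g a w, Φ (g * a) w = φ w g (Φ a w) := fun g a w =>
    congrArg (fun f : α ≃o α => f (x w)) (map_mul (φ w) g a)
  refine ⟨LinearOrder.lift' Φ hΦ, ⟨fun g a b hab => ?_⟩⟩
  obtain ⟨w, hw, hlt⟩ : ∃ w, (∀ v < w, Φ a v = Φ b v) ∧ Φ a w < Φ b w := hab
  refine (⟨w, fun v hv => ?_, ?_⟩ :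
    ∃ w, (∀ v < w, Φ (g * a) v = Φ (g * b) v) ∧ Φ (g * a) w < Φ (g * b) w)
  · rw [hmul, hmul, hw v hv]
  · rw [hmul, hmul]
    exact (φ w g).strictMono hlt

theorem exists_mulLeftStrictMono_of_isFreeGroup (F : Type*) [Group F] [IsFreeGroup F] :
    ∃ _ : LinearOrder F, MulLeftStrictMono F := by
  let e := IsFreeGroup.toFreeGroup F
  refine exists_mulLeftStrictMono_of_orderIso_actions (α := ℚ) fun g hg => ?_
  obtain ⟨φ, q, hq⟩ := exists_orderIso_action_ne ((map_ne_one_iff e e.injective).2 hg)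
  exact ⟨φ.comp e.toMonoidHom, q, hq⟩

end LeftOrder

/-! ### The Cayley tree -/

section CayleyGraph

variable {ι F : Type*} [Group F]

/-- The edges `x → x * b i` of the Cayley graph of `F` with respect to a family `b`, as pairs of
vertices. The lexicographic product makes them inherit an invariant order from `F`. -/
def cayleyEdges (b : ι → F) : SubMulAction F (F ×ₗ F) where
  carrier := {e | (ofLex e).1⁻¹ * (ofLex e).2 ∈ range b}
  smul_mem' g e he := by
    simpa [mul_assoc] using he

/-- The Cayley graph of `F` with respect to a family `b`, on which `F` acts by left
multiplication. -/
def cayleyGraph (b : ι → F) : Multidigraph F (cayleyEdges b) where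
  src e := (ofLex (e : F ×ₗ F)).1
  tgt e := (ofLex (e : F ×ₗ F)).2

/-- The edge from `x` to `x * b i`. -/
def cayleyEdge (b : ι → F) (x : F) (i : ι) : cayleyEdges b :=
  ⟨toLex (x, x * b i), i, (inv_mul_cancel_left x (b i)).symm⟩

theorem exists_eq_cayleyEdge {b : ι → F} (e : cayleyEdges b) : ∃ x i, e = cayleyEdge b x i := by
  obtain ⟨⟨x, y⟩, i, hi⟩ := e
  have hi : b i = x⁻¹ * y := hi
  exact ⟨x, i, Subtype.ext (congrArg (fun z => toLex (x, z)) (by rw [hi, mul_inv_cancel_left]))⟩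

theorem cayleyGraph_isEquivariant (b : ι → F) : (cayleyGraph b).IsEquivariant F :=
  fun _ => ⟨fun _ => rfl, fun _ => rfl⟩

theorem cayleyGraph_isConnected {b : ι → F} (hb : Subgroup.closure (range b) = ⊤) :
    (cayleyGraph b).IsConnected := by
  let r := (cayleyGraph b).joined univ
  have hmul (g : F) : ∀ x, r x (x * g) := by
    induction hb ▸ Subgroup.mem_top g using Subgroup.closure_induction with
    | mem _ h =>
      obtain ⟨i, rfl⟩ := h
      exact fun x => Multidigraph.joined_src_tgt (mem_univ (cayleyEdge b x i))
    | one => exact fun x => (mul_one x).symm ▸ r.refl x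
    | mul g h _ _ hg hh => exact fun x => mul_assoc x g h ▸ r.trans (hg x) (hh (x * g))
    | inv g _ hg =>
      intro x
      have := hg (x * g⁻¹)
      rw [inv_mul_cancel_right] at this
      exact r.symm this
  exact fun x y => mul_inv_cancel_left x y ▸ hmul (x⁻¹ * y) x

theorem cayleyGraph_isForest (b : FreeGroupBasis ι F) : (cayleyGraph b).IsForest := by
  intro c
  -- Moving along the edges while adding up `c` is an action of `F` by permutations of `F × ℚ`,
  -- because `F` is free; the orbit of `(1, 0)` is the graph of a potential.
  let P (i : ι) : Equiv.Perm (F × ℚ) :=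
    Equiv.prodShear (Equiv.mulRight (b i)) fun x => Equiv.addRight (c (cayleyEdge b x i))
  let ψ : F →* Equiv.Perm (F × ℚ) := b.lift fun i => (P i)⁻¹
  have hψ : ∀ i, ψ (b i) = (P i)⁻¹ := congrFun (b.lift.symm_apply_apply _)
  have hfst (g : F) : ∀ p, (ψ g p).1 = p.1 * g⁻¹ := by
    induction closure_range_freeGroupBasis b ▸ Subgroup.mem_top g
        using Subgroup.closure_induction with
    | mem _ h =>
      obtain ⟨i, rfl⟩ := h
      exact fun p => by rw [hψ]; rfl
    | one => simp
    | mul g h _ _ hg hh =>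
      intro p
      rw [map_mul, Equiv.Perm.mul_apply, hg, hh, mul_inv_rev, mul_assoc]
    | inv g _ hg =>
      intro p
      have := hg (ψ g⁻¹ p)
      rw [← Equiv.Perm.mul_apply, ← map_mul, mul_inv_cancel, map_one] at this
      rw [eq_mul_inv_iff_mul_eq]
      exact this.symm
  refine ⟨fun x => (ψ x⁻¹ (1, 0)).2, fun e => ?_⟩
  obtain ⟨x, i, rfl⟩ := exists_eq_cayleyEdge e
  have hstep : ψ (x * b i)⁻¹ (1, 0) = P i (ψ x⁻¹ (1, 0)) := by
    rw [mul_inv_rev, map_mul, map_inv, hψ, inv_inv, Equiv.Perm.mul_apply]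
  have hx : (ψ x⁻¹ (1, 0)).1 = x := by rw [hfst, one_mul, inv_inv]
  change (ψ (x * b i)⁻¹ (1, 0)).2 - (ψ x⁻¹ (1, 0)).2 = _
  rw [hstep]
  change (ψ x⁻¹ (1, 0)).2 + c (cayleyEdge b (ψ x⁻¹ (1, 0)).1 i) - _ = _
  rw [hx, add_sub_cancel_left]

instance covariantClass_smul_lt {L : Type*} [Group L] [LT L] [MulLeftStrictMono L] :
    CovariantClass L L HSMul.hSMul LT.lt :=
  ⟨fun g _ _ h => mul_lt_mul_right h g⟩

instance covariantClass_lex_smul_lt {L α β : Type*} [Group L] [MulAction L α] [MulAction L β]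
    [LT α] [LT β] [CovariantClass L α HSMul.hSMul LT.lt]
    [CovariantClass L β HSMul.hSMul LT.lt] : CovariantClass L (α ×ₗ β) HSMul.hSMul LT.lt :=
  ⟨fun g p q h => by
    rw [Prod.Lex.lt_iff] at h ⊢
    exact h.imp (CovariantClass.elim (μ := HSMul.hSMul) g) fun h =>
      ⟨congrArg (g • ·) h.1, CovariantClass.elim (μ := HSMul.hSMul) g h.2⟩⟩

end CayleyGraph

theorem theorem1p1_general {F : Type*} [Group F] [IsFreeGroup F] (H K : Subgroup F)
    [Group.FG H] [Group.FG K] (hH : H ≠ ⊥) (hK : K ≠ ⊥) :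
    ∃ _ : Group.FG (H ⊓ K : Subgroup F),
      (Group.rank (H ⊓ K : Subgroup F) : ℚ) - 1 ≤
        ((Group.rank H : ℚ) - 1) * ((Group.rank K : ℚ) - 1) := by
  let b := IsFreeGroup.basis F
  obtain ⟨_, _⟩ := exists_mulLeftStrictMono_of_isFreeGroup F
  have hconn := cayleyGraph_isConnected (closure_range_freeGroupBasis b)
  have hequiv := cayleyGraph_isEquivariant b
  obtain ⟨X, h1X, hX, _⟩ := hconn.exists_cofinite_connectedOn (hequiv.subgroup H) 1
  obtain ⟨Y, h1Y, hY, _⟩ := hconn.exists_cofinite_connectedOn (hequiv.subgroup K) 1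
  have := (Subgroup.nontrivial_iff_ne_bot H).2 hH
  have := (Subgroup.nontrivial_iff_ne_bot K).2 hK
  have := finite_firstCohomology_of_fg (L := H)
  have := finite_firstCohomology_of_fg (L := K)
  obtain ⟨_, hle⟩ := (cayleyGraph_isForest b).finite_firstCohomology_inf_and_firstBetti_le
    hequiv hX hY ⟨1, h1X, h1Y⟩
  have hfg : Group.FG (H ⊓ K : Subgroup F) := fg_of_finite_firstCohomology
  refine ⟨hfg, ?_⟩
  rwa [rank_eq_firstBetti, rank_eq_firstBetti, rank_eq_firstBetti]

theorem theorem1p1 {F : Type*} [Group F] [IsFreeGroup F] (H K : Subgroup F)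
    [Group.FG H] [Group.FG K] (hH : H ≠ ⊥) (hK : K ≠ ⊥) (h k : ℕ)
    (hh : Group.rank H = h) (hk : Group.rank K = k)
    (hjoin : ((h : ℚ) + (k : ℚ) - 1) / 2 ≤ (Group.rank (H ⊔ K : Subgroup F) : ℚ) - 1) :
    ∃ _ : Group.FG (H ⊓ K : Subgroup F),
      (Group.rank (H ⊓ K : Subgroup F) : ℚ) - 1 ≤ ((h : ℚ) - 1) * ((k : ℚ) - 1) := by
  subst hh hk
  exact theorem1p1_general H K hH hK
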